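/- Let $\mathbf{Sym}=\mathbb{Q}\langle S_1,S_2,\dots\rangle$ be the algebra of noncommutative symmetric functions (the free associative algebra on $S_1,S_2,\dots$, graded by $\deg S_k=k$, with $S_0=1$), and let $g=\sum_{n\ge 0}g_n$, with $g_n$ homogeneous of degree $n$, be the unique solution of $g=\sum_{k\ge 0}S_k\,g^k$. Regard $g_n$ as a commutative symmetric function through $S_k\mapsto h_k$ (the complete homogeneous symmetric functions), and put $$P_n(t,q)=(q)_n\; g_n\!\left(\frac{1-x}{1-q}\right)\Big|_{x=-t},\qquad (q)_n=\prod_{i=1}^n(1-q^i),$$ where $f\mapsto f\bigl(\frac{1-x}{1-q}\bigr)$ is the algebra homomorphism defined on symmetric functions by sending the power sum $p_k$ to $\frac{1-x^k}{1-q^k}$ for all $k\ge1$ (expanded as a power series in $q$). Let $P_n(t)=P_n(t,0)$. A Schröder path of semilength $n$ is a lattice path from $(0,0)$ to $(2n,0)$ with steps $(1,1)$, $(1,-1)$ and $(2,0)$ (the last called horizontal) that never goes below the horizontal axis. For $n\ge 1$ let $c_n(t)=\sum_{k=1}^{n}\frac1n\binom nk\binom n{k-1}t^{k-1}$ be the Narayana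 polynomial. Corollary (Schröder paths and Lassalle's formula). 1. For all $n,k\ge0$, the coefficient of $t^k$ in $P_n(t)$ is the number of Schröder paths of semilength $n$ with exactly $k$ horizontal steps. 2. As formal power series in $z$ over $\mathbb{Q}[t]$, $$\sum_{n\ge0}P_n(t)z^n=\frac{1-tz-\sqrt{(1-tz)^2-4z}}{2z},$$ where the square root is the one with constant term $1$. 3. For all $n\ge1$, the generating polynomial of Schröder paths of semilength $n$ by number of horizontal steps (the sum of $t^{\#\text{horizontal steps}}$ over these paths) is $(t+1)\,c_n(t+1)$. 4. (Lassalle's formula) For all $n\ge1$, $t\,c_n(t)=P_n(t-1)$. -/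

import Mathlib

namespace SuperNarayana

/-! ### Noncommutative symmetric functions and the Lagrange series -/

/-- The algebra **Sym** of noncommutative symmetric functions over `ℚ`: the free associative algebra
on a sequence `S₁, S₂, …`; the free generator with index `i : ℕ` stands for `S_{i+1}`. -/
abbrev NSym : Type := FreeAlgebra ℚ ℕ

/-- The complete functions `S_n`, with `S₀ = 1`. -/
def S : ℕ → NSym
  | 0 => 1
  | i + 1 => FreeAlgebra.ι ℚ i

/-- The degree `m` component `g_m` of the noncommutative Lagrange series `g`, the solution
of `g = ∑ S_k g^k`.  Only the components of degree `< m` contribute to the component of degree `m`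
of the right-hand side, so the equation is solved recursively (see `g_spec` and `g_unique`). -/
noncomputable def g (m : ℕ) : NSym :=
  ∑ k ∈ Finset.range (m + 1),
    S k * PowerSeries.coeff (m - k)
      ((PowerSeries.mk fun i => if _h : i < m then g i else 0) ^ k)
termination_by m

/-- `f(z) = ∑ f_n z^n` solves `f(z) = ∑_k S_k z^k f(z)^k` (comparing coefficients of `z^m`). -/
def IsSolution (f : ℕ → NSym) : Prop :=
  ∀ m, f m = ∑ k ∈ Finset.range (m + 1),
    S k * PowerSeries.coeff (m - k) (PowerSeries.mk f ^ k)

theorem coeff_pow_congr {R : Type*} [Semiring R] {a b : PowerSeries R} {m : ℕ}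
    (h : ∀ i ≤ m, PowerSeries.coeff i a = PowerSeries.coeff i b) (k : ℕ) :
    ∀ i ≤ m, PowerSeries.coeff i (a ^ k) = PowerSeries.coeff i (b ^ k) := by
  induction k with
  | zero => intro i _; simp
  | succ k ih =>
    intro i hi
    rw [pow_succ, pow_succ, PowerSeries.coeff_mul, PowerSeries.coeff_mul]
    refine Finset.sum_congr rfl fun p hp => ?_
    have hp' := Finset.HasAntidiagonal.mem_antidiagonal.mp hp
    rw [ih p.1 (by omega), h p.2 (by omega)]

theorem sum_congr_below {a b : ℕ → NSym} {m : ℕ} (h : ∀ i < m, a i = b i) :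
    ∑ k ∈ Finset.range (m + 1), S k * PowerSeries.coeff (m - k) (PowerSeries.mk a ^ k) =
    ∑ k ∈ Finset.range (m + 1), S k * PowerSeries.coeff (m - k) (PowerSeries.mk b ^ k) := by
  refine Finset.sum_congr rfl fun k hk => ?_
  rcases Nat.eq_zero_or_pos k with rfl | hk0
  · simp
  have hkm := Finset.mem_range.mp hk
  congr 1
  refine coeff_pow_congr (m := m - k) (fun i hi => ?_) _ _ le_rfl
  simpa using h i (by omega)

theorem g_spec : IsSolution g := by
  intro m
  rw [g]
  exact sum_congr_below fun i hi => by simp [hi]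

theorem g_unique {f : ℕ → NSym} (hf : IsSolution f) : f = g := by
  funext m
  induction m using Nat.strong_induction_on with
  | _ m ih => rw [hf m, g_spec m]; exact sum_congr_below ih

/-! ### Commutative symmetric functions and the character -/

/-- The algebra of symmetric functions over `ℚ`, as the polynomial algebra in the power sums
`p₁, p₂, …`; the variable with index `i : ℕ` stands for `p_{i+1}`. -/
abbrev SymFun : Type := MvPolynomial ℕ ℚ

/-- The complete homogeneous symmetric functions, by Newton's formula
`n h_n = ∑_{i=1}^{n} p_i h_{n-i}`, `h₀ = 1`. -/
noncomputable def h : ℕ → SymFun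
  | 0 => 1
  | n + 1 => MvPolynomial.C (1 / ((n : ℚ) + 1)) *
      ∑ i : Fin (n + 1), MvPolynomial.X (i : ℕ) * h (n - (i : ℕ))
termination_by n => n
decreasing_by omega

/-- The commutative image, `S_n ↦ h_n`. -/
noncomputable def commImage : NSym →ₐ[ℚ] SymFun :=
  FreeAlgebra.lift ℚ fun i => h (i + 1)

/-- `g_n` as a commutative symmetric function. -/
noncomputable def gComm (n : ℕ) : SymFun := commImage (g n)

/-- Evaluation at the virtual alphabet `(1-x)/(1-q)`: the character sending the power sum `p_k` to
`(1 - x^k)/(1 - q^k)`, expanded as a formal power series in `q`. -/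
noncomputable def evalSuper {R : Type*} [CommRing R] [Algebra ℚ R] (x : R) :
    SymFun →ₐ[ℚ] PowerSeries R :=
  MvPolynomial.aeval fun i =>
    PowerSeries.C (1 - x ^ (i + 1)) *
      PowerSeries.invOfUnit (1 - (PowerSeries.X : PowerSeries R) ^ (i + 1)) 1

/-- `(q)_n = (1-q)(1-q²)⋯(1-qⁿ)`. -/
noncomputable def qPoch (R : Type*) [CommRing R] (n : ℕ) : PowerSeries R :=
  ∏ i ∈ Finset.range n, (1 - (PowerSeries.X : PowerSeries R) ^ (i + 1))

/-- The super-Narayana polynomial `P_n(t,q) = (q)_n g_n((1-x)/(1-q))` at `x = -t`, as a power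
series in `q` with coefficients in `ℚ[t]`. -/
noncomputable def superNarayana (n : ℕ) : PowerSeries (Polynomial ℚ) :=
  qPoch (Polynomial ℚ) n * evalSuper (-Polynomial.X : Polynomial ℚ) (gComm n)

/-- `P_n(t) = P_n(t,0)`. -/
noncomputable def P (n : ℕ) : Polynomial ℚ :=
  PowerSeries.constantCoeff (superNarayana n)

/-- The Narayana polynomial `c_n(t) = ∑_{k=1}^{n} (1/n) binom(n,k) binom(n,k-1) t^{k-1}`,
for `n ≥ 1`. -/
noncomputable def narayana (n : ℕ) : Polynomial ℚ :=
  ∑ j ∈ Finset.range n,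
    Polynomial.C (((n.choose (j + 1) : ℚ) * (n.choose j : ℚ)) / (n : ℚ)) * Polynomial.X ^ j

/-! ### Schröder paths -/

/-- Up step `(1,1)`, down step `(1,-1)`, horizontal step `(2,0)`. -/
inductive Step : Type
  | up
  | down
  | horiz
  deriving DecidableEq

instance : Fintype Step where
  elems := {Step.up, Step.down, Step.horiz}
  complete := by intro s; cases s <;> simp

/-- Horizontal displacement of a step. -/
def Step.dx : Step → ℕ
  | .up => 1
  | .down => 1
  | .horiz => 2

/-- Vertical displacement of a step. -/
def Step.dy : Step → ℤ
  | .up => 1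
  | .down => -1
  | .horiz => 0

/-- `w` is a Schröder path of semilength `n`: it goes from `(0,0)` to `(2n,0)` and never passes
below the horizontal axis. -/
def IsSchroderPath (n : ℕ) (w : List Step) : Prop :=
  (w.map Step.dx).sum = 2 * n ∧ (w.map Step.dy).sum = 0 ∧
    ∀ v : List Step, v <+: w → 0 ≤ (v.map Step.dy).sum

theorem length_le_dx (w : List Step) : w.length ≤ (w.map Step.dx).sum := by
  induction w with
  | nil => simp
  | cons s w ih =>
    have : 1 ≤ s.dx := by cases s <;> simp [Step.dx]
    simp only [List.length_cons, List.map_cons, List.sum_cons]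
    omega

theorem finite_schroder (n : ℕ) : {w : List Step | IsSchroderPath n w}.Finite :=
  (List.finite_length_le Step (2 * n)).subset fun w hw => (length_le_dx w).trans hw.1.le

/-- The finite set of Schröder paths of semilength `n`. -/
noncomputable def schroderPaths (n : ℕ) : Finset (List Step) := (finite_schroder n).toFinset

/-- The number of horizontal steps of a path. -/
def horizCount (w : List Step) : ℕ := w.count Step.horiz

end SuperNarayana

namespace SuperNarayana

/-! At `q = 0` the character sends every `h_n` with `n ≥ 1` to `1 - x = 1 + t`
(`constantCoeff_evalSuper_h`). The Lagrange equation then becomes `p = 1 + (1 + t) ∑_{k≥1} (z p)^k`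
for `p = ∑ P_n z^n`, and summing the geometric series gives `p = 1 + t z p + z p²` (`P_quadratic`).
Completing the square yields the closed form.

The first-return decomposition (`isExcursion_iff`, unique by `append_down_injective`) gives the path
polynomials the same quadratic recursion, hence `schroderPoly_eq_P`.

For Lassalle's formula, the square root satisfies a first-order linear differential equation, which
gives a three-term recurrence for `P_n` (`P_recurrence`). Shifting `t` to `t - 1` turns it into the
recurrence of the Narayana polynomials, checked on binomials (`narayana_recurrence`). -/

open PowerSeries (mk coeff constantCoeff)
open Polynomial (X C)

/-! ### The character at `q = 0` -/

/-- The specialization of `Sym` at `(1 - x)/(1 - q)`, `x = -t`, `q = 0`. -/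
noncomputable def charZero : NSym →+* Polynomial ℚ :=
  (constantCoeff (R := Polynomial ℚ)).comp
    ((evalSuper (-X : Polynomial ℚ)).toRingHom.comp commImage.toRingHom)

theorem constantCoeff_evalSuper_X {R : Type*} [CommRing R] [Algebra ℚ R] (x : R) (i : ℕ) :
    constantCoeff (evalSuper x (MvPolynomial.X i)) = 1 - x ^ (i + 1) := by
  simp [evalSuper]

/-- With `p_k ↦ 1 - x^k`, the generating series of the `h_n` is `(1 - x z)/(1 - z)`. The induction
verifies this through Newton's formula; the term containing `h 0 = 1` is split off, since it does
not follow the pattern. -/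
theorem constantCoeff_evalSuper_h {R : Type*} [CommRing R] [Algebra ℚ R] (x : R) (n : ℕ) :
    constantCoeff (evalSuper x (h (n + 1))) = 1 - x := by
  induction n using Nat.strong_induction_on with
  | _ n ih =>
    have key : ∑ i : Fin (n + 1), (1 - x ^ ((i : ℕ) + 1)) *
        constantCoeff (evalSuper x (h (n - (i : ℕ)))) = ((n : R) + 1) * (1 - x) := by
      rw [Fin.sum_univ_eq_sum_range
        (fun i => (1 - x ^ (i + 1)) * constantCoeff (evalSuper x (h (n - i)))) (n + 1),
        Finset.sum_range_succ]
      have hs : ∑ i ∈ Finset.range n, (1 - x ^ (i + 1)) *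
          constantCoeff (evalSuper x (h (n - i))) =
          ∑ i ∈ Finset.range n, (1 - x ^ (i + 1)) * (1 - x) := by
        refine Finset.sum_congr rfl fun i hi => ?_
        have hi := Finset.mem_range.mp hi
        rw [show n - i = (n - i - 1) + 1 by omega, ih _ (by omega)]
      rw [hs, Nat.sub_self, show h 0 = 1 by rw [h], map_one, map_one, ← Finset.sum_mul,
        Finset.sum_sub_distrib]
      simp only [pow_succ, ← Finset.sum_mul, Finset.sum_const, Finset.card_range, nsmul_eq_mul]
      linear_combination (-x) * mul_neg_geom_sum x n
    rw [h, map_mul, map_mul, map_sum, map_sum]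
    simp only [map_mul, constantCoeff_evalSuper_X]
    rw [key]
    have hC : evalSuper x (MvPolynomial.C (1 / ((n : ℚ) + 1))) =
        algebraMap ℚ (PowerSeries R) (1 / ((n : ℚ) + 1)) := by
      rw [← MvPolynomial.algebraMap_eq, AlgHom.commutes]
    rw [hC, PowerSeries.algebraMap_apply, PowerSeries.constantCoeff_C, ← mul_assoc]
    have : algebraMap ℚ R (1 / ((n : ℚ) + 1)) * ((n : R) + 1) = 1 := by
      have h1 : ((n : R) + 1) = algebraMap ℚ R ((n : ℚ) + 1) := by simp
      rw [h1, ← map_mul, one_div_mul_cancel (by positivity), map_one]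
    rw [this, one_mul]

theorem charZero_S_succ (k : ℕ) : charZero (S (k + 1)) = 1 + X := by
  have : commImage (S (k + 1)) = h (k + 1) := by simp [S, commImage]
  change constantCoeff (evalSuper _ (commImage (S (k + 1)))) = _
  rw [this, constantCoeff_evalSuper_h, sub_neg_eq_add]

theorem P_eq_charZero (n : ℕ) : P n = charZero (g n) := by
  have : constantCoeff (qPoch (Polynomial ℚ) n) = 1 := by
    simp [qPoch, map_prod]
  rw [P, superNarayana, map_mul, this, one_mul]
  rfl

theorem map_lagrange {R : Type*} [Semiring R] (φ : NSym →+* R) (m : ℕ) :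
    φ (g m) = ∑ k ∈ Finset.range (m + 1), φ (S k) *
      coeff (m - k) ((mk fun n => φ (g n)) ^ k) := by
  have hmk : (mk fun n => φ (g n)) = PowerSeries.map φ (mk g) := by
    ext1 n
    rw [PowerSeries.coeff_map, PowerSeries.coeff_mk, PowerSeries.coeff_mk]
  rw [hmk, g_spec m, map_sum]
  refine Finset.sum_congr rfl fun k _ => ?_
  rw [map_mul, ← map_pow, PowerSeries.coeff_map]

theorem P_lagrange (m : ℕ) :
    P m = ∑ k ∈ Finset.range (m + 1), charZero (S k) * coeff (m - k) (mk P ^ k) := by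
  rw [P_eq_charZero, map_lagrange, funext P_eq_charZero]

/-! ### The quadratic equation -/

theorem P_quadratic :
    mk P = 1 + PowerSeries.C X * PowerSeries.X * mk P + PowerSeries.X * mk P ^ 2 := by
  set p := mk P with hp
  set z : PowerSeries (Polynomial ℚ) := PowerSeries.X with hz
  set t : PowerSeries (Polynomial ℚ) := PowerSeries.C X with ht
  ext1 m
  -- Truncated geometric series: working modulo `z ^ (m + 1)` avoids the infinite sum, as `(z p)^k`
  -- vanishes there for `k > m`.
  set T := ∑ k ∈ Finset.range (m + 1), (z * p) ^ k with hT
  have hgeom : (1 - z * p) * T = 1 - (z * p) ^ (m + 1) := mul_neg_geom_sum _ _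
  have hdvd : z ^ (m + 1) ∣ p - (1 + (1 + t) * (T - 1)) := by
    rw [hz, PowerSeries.X_pow_dvd_iff]
    intro n hn
    have hcoeff : ∀ k, coeff n ((z * p) ^ k) = if k ≤ n then coeff (n - k) (p ^ k) else 0 := by
      intro k
      rw [mul_pow, hz, PowerSeries.coeff_X_pow_mul']
    have h1 : T - 1 = ∑ k ∈ Finset.range m, (z * p) ^ (k + 1) := by
      rw [hT, Finset.sum_range_succ', pow_zero, add_sub_cancel_right]
    have h2 : coeff n (T - 1) = ∑ k ∈ Finset.range n, coeff (n - (k + 1)) (p ^ (k + 1)) := by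
      rw [h1, map_sum]
      simp only [hcoeff]
      rw [← Finset.sum_filter]
      refine Finset.sum_congr ?_ fun _ _ => rfl
      ext k
      simp only [Finset.mem_filter, Finset.mem_range]
      omega
    have h3 : coeff n ((1 + t) * (T - 1)) = (1 + X) * coeff n (T - 1) := by
      rw [show (1 + t) = PowerSeries.C (1 + X) by simp [ht], PowerSeries.coeff_C_mul]
    rw [map_sub, map_add, h3, h2, hp, PowerSeries.coeff_mk, P_lagrange, Finset.sum_range_succ',
      Finset.mul_sum]
    simp only [charZero_S_succ]
    simp only [S, Nat.sub_zero, pow_zero, map_one, one_mul]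
    ring
  have hmod : z ^ (m + 1) ∣ p - (1 + t * z * p + z * p ^ 2) := by
    obtain ⟨c, hc⟩ := hdvd
    -- Clearing the denominator `1 - z p` multiplies `c` by it; the second term is the tail of the
    -- truncated geometric series.
    refine ⟨(1 - z * p) * c - (1 + t) * p ^ (m + 1), ?_⟩
    rw [mul_pow] at hgeom
    linear_combination (1 - z * p) * hc + (1 + t) * hgeom
  rw [hz, PowerSeries.X_pow_dvd_iff] at hmod
  exact sub_eq_zero.mp (by simpa only [map_sub] using hmod m (Nat.lt_succ_self m))

theorem P_zero : P 0 = 1 := by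
  have := congrArg (coeff 0) P_quadratic
  simpa [mul_assoc] using this

theorem P_succ (n : ℕ) :
    P (n + 1) = X * P n + ∑ ij ∈ Finset.HasAntidiagonal.antidiagonal n, P ij.1 * P ij.2 := by
  have := congrArg (coeff (n + 1)) P_quadratic
  rw [map_add, map_add, mul_assoc, PowerSeries.coeff_C_mul, PowerSeries.coeff_succ_X_mul,
    PowerSeries.coeff_succ_X_mul, sq, PowerSeries.coeff_mul] at this
  simpa [PowerSeries.coeff_one] using this

theorem exists_sqrt :
    ∃ r : PowerSeries (Polynomial ℚ),
      r ^ 2 = (1 - PowerSeries.C (X : Polynomial ℚ) * PowerSeries.X) ^ 2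
        - 4 * PowerSeries.X ∧
      constantCoeff r = 1 ∧
      2 * PowerSeries.X * mk P =
        1 - PowerSeries.C (X : Polynomial ℚ) * PowerSeries.X - r := by
  refine ⟨1 - PowerSeries.C X * PowerSeries.X - 2 * PowerSeries.X * mk P, ?_, ?_, by ring⟩
  · linear_combination (-4 * PowerSeries.X) * P_quadratic
  · simp

/-! ### First-return decomposition of Schröder paths -/

/-- The final height of a path. -/
def height (w : List Step) : ℤ := (w.map Step.dy).sum

/-- Twice the semilength of a path. -/
def width (w : List Step) : ℕ := (w.map Step.dx).sum

@[simp] theorem height_nil : height [] = 0 := rfl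
@[simp] theorem height_cons (s : Step) (w : List Step) : height (s :: w) = s.dy + height w := by
  simp [height]
@[simp] theorem height_append (v w : List Step) : height (v ++ w) = height v + height w := by
  simp [height]
@[simp] theorem width_nil : width [] = 0 := rfl
@[simp] theorem width_cons (s : Step) (w : List Step) : width (s :: w) = s.dx + width w := by
  simp [width]
@[simp] theorem width_append (v w : List Step) : width (v ++ w) = width v + width w := by
  simp [width]

theorem prefix_append_iff {α : Type*} {u a b : List α} :
    u <+: a ++ b ↔ u <+: a ∨ ∃ c, u = a ++ c ∧ c <+: b := by
  constructor
  · rintro ⟨s, hs⟩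
    rcases List.append_eq_append_iff.mp hs with ⟨c, rfl, -⟩ | ⟨c, rfl, rfl⟩
    · exact Or.inl ⟨c, rfl⟩
    · exact Or.inr ⟨c, rfl, s, rfl⟩
  · rintro (hu | ⟨c, rfl, hc⟩)
    · exact List.prefix_append_of_prefix hu
    · exact (List.prefix_append_right_inj a).mpr hc

/-- A path returning to the axis without passing below it. -/
def IsExcursion (w : List Step) : Prop :=
  height w = 0 ∧ ∀ v : List Step, v <+: w → 0 ≤ height v

theorem isSchroderPath_iff {n : ℕ} {w : List Step} :
    IsSchroderPath n w ↔ width w = 2 * n ∧ IsExcursion w := Iff.rfl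

theorem isExcursion_nil : IsExcursion [] :=
  ⟨rfl, fun v hv => by rw [List.prefix_nil.mp hv]; rfl⟩

theorem isExcursion_horiz_cons {w : List Step} :
    IsExcursion (Step.horiz :: w) ↔ IsExcursion w := by
  simp only [IsExcursion, height_cons, Step.dy, zero_add, List.prefix_cons_iff]
  refine and_congr_right fun _ => ⟨fun H v hv => ?_, fun H v hv => ?_⟩
  · simpa [Step.dy] using H (Step.horiz :: v) (Or.inr ⟨v, rfl, hv⟩)
  · rcases hv with rfl | ⟨u, rfl, hu⟩
    · simp
    · simpa [Step.dy] using H u hu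

theorem isExcursion_up_append_down {a b : List Step} (ha : IsExcursion a) (hb : IsExcursion b) :
    IsExcursion (Step.up :: a ++ Step.down :: b) := by
  refine ⟨by simp [Step.dy, ha.1, hb.1], fun v hv => ?_⟩
  rw [List.cons_append, List.prefix_cons_iff] at hv
  rcases hv with rfl | ⟨u, rfl, hu⟩
  · simp
  rcases prefix_append_iff.mp hu with hu | ⟨c, rfl, hc⟩
  · have := ha.2 u hu
    simp only [height_cons, Step.dy]
    omega
  rw [List.prefix_cons_iff] at hc
  rcases hc with rfl | ⟨d, rfl, hd⟩
  · simp [Step.dy, ha.1]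
  · simpa [Step.dy, ha.1] using hb.2 d hd

/-- Every path ending at or below the axis splits at its first passage below the axis. -/
theorem exists_excursion_prefix (w : List Step) (hw : height w ≤ 0) :
    ∃ a r, w = a ++ r ∧ IsExcursion a ∧ (r = [] ∨ ∃ r', r = Step.down :: r') := by
  induction hl : w.length using Nat.strong_induction_on generalizing w with
  | _ l ih =>
    match w, hw, hl with
    | [], _, _ => exact ⟨[], [], rfl, isExcursion_nil, Or.inl rfl⟩
    | Step.down :: w, _, _ => exact ⟨[], _, rfl, isExcursion_nil, Or.inr ⟨w, rfl⟩⟩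
    | Step.horiz :: w, hw, hl =>
      obtain ⟨a, r, rfl, ha, hr⟩ := ih w.length (by simp at hl; omega) w
        (by simpa [Step.dy] using hw) rfl
      exact ⟨Step.horiz :: a, r, rfl, isExcursion_horiz_cons.mpr ha, hr⟩
    | Step.up :: w, hw, hl =>
      simp only [height_cons, Step.dy] at hw
      obtain ⟨a, r, rfl, ha, hr⟩ := ih w.length (by simp at hl; omega) w (by omega) rfl
      rcases hr with rfl | ⟨s, rfl⟩
      · simp [ha.1] at hw
      simp only [height_append, height_cons, ha.1, Step.dy] at hw
      -- The down step matching the initial up step brings the path back to the axis, so the search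
      -- continues in the tail.
      obtain ⟨b, r, rfl, hb, hr⟩ := ih s.length (by simp at hl; omega) s (by omega) rfl
      exact ⟨Step.up :: a ++ Step.down :: b, r, by simp, isExcursion_up_append_down ha hb, hr⟩

theorem IsExcursion.not_down_prefix {a w : List Step} (ha : IsExcursion a) (hw : IsExcursion w) :
    ¬ a ++ [Step.down] <+: w := fun H => by
  have := hw.2 _ H
  simp [ha.1, Step.dy] at this

/-- After an initial up step the rest ends at `-1`, so it splits at its first passage below its
start. The tail is again split; a second such passage would take the whole path below the axis. -/
theorem isExcursion_iff {w : List Step} :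
    IsExcursion w ↔ w = [] ∨ (∃ v, IsExcursion v ∧ w = Step.horiz :: v) ∨
      ∃ a b, IsExcursion a ∧ IsExcursion b ∧ w = Step.up :: a ++ Step.down :: b := by
  constructor
  · intro hw
    match w, hw with
    | [], _ => exact Or.inl rfl
    | Step.horiz :: w, hw => exact Or.inr (Or.inl ⟨w, isExcursion_horiz_cons.mp hw, rfl⟩)
    | Step.down :: w, hw =>
      exact absurd (by simp) (isExcursion_nil.not_down_prefix hw)
    | Step.up :: w, hw =>
      have h0 : height w = -1 := by
        have := hw.1
        simp only [height_cons, Step.dy] at this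
        omega
      obtain ⟨a, r, rfl, ha, hr⟩ := exists_excursion_prefix w (by omega)
      rcases hr with rfl | ⟨s, rfl⟩
      · simp [ha.1] at h0
      obtain ⟨b, r, rfl, hb, hr⟩ := exists_excursion_prefix s
        (by simp only [height_append, height_cons, ha.1, Step.dy] at h0; omega)
      rcases hr with rfl | ⟨s, rfl⟩
      · exact Or.inr (Or.inr ⟨a, b, ha, hb, by simp⟩)
      · refine absurd ⟨s, ?_⟩ ((isExcursion_up_append_down ha hb).not_down_prefix hw)
        simp
  · rintro (rfl | ⟨v, hv, rfl⟩ | ⟨a, b, ha, hb, rfl⟩)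
    · exact isExcursion_nil
    · exact isExcursion_horiz_cons.mpr hv
    · exact isExcursion_up_append_down ha hb

/-- If one excursion were a proper prefix of the other, the longer one would continue it with a down
step and reach height `-1`. -/
theorem append_down_injective {a b a' b' : List Step} (ha : IsExcursion a) (ha' : IsExcursion a')
    (H : a ++ Step.down :: b = a' ++ Step.down :: b') : a = a' ∧ b = b' := by
  rcases List.append_eq_append_iff.mp H with ⟨c, rfl, hc⟩ | ⟨c, rfl, hc⟩
  · rcases c with _ | ⟨s, c⟩
    · simpa using hc
    · obtain ⟨rfl, -⟩ := List.cons.inj hc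
      exact absurd ⟨c, by simp⟩ (ha.not_down_prefix ha')
  · rcases c with _ | ⟨s, c⟩
    · simpa [eq_comm] using hc
    · obtain ⟨rfl, -⟩ := List.cons.inj hc
      exact absurd ⟨c, by simp⟩ (ha'.not_down_prefix ha)

theorem IsExcursion.even_width {w : List Step} (hw : IsExcursion w) : ∃ n, width w = 2 * n := by
  -- Each step changes width minus height by 0 or 2.
  have key : ∀ w : List Step, ∃ k : ℤ, (width w : ℤ) = height w + 2 * k := by
    intro w
    induction w with
    | nil => exact ⟨0, rfl⟩
    | cons s w ih =>
      obtain ⟨k, hk⟩ := ih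
      cases s
      · exact ⟨k, by simp [Step.dx, Step.dy]; omega⟩
      · exact ⟨k + 1, by simp [Step.dx, Step.dy]; omega⟩
      · exact ⟨k + 1, by simp [Step.dx, Step.dy]; omega⟩
  obtain ⟨k, hk⟩ := key w
  rw [hw.1] at hk
  exact ⟨k.toNat, by omega⟩

theorem mem_schroderPaths {n : ℕ} {w : List Step} :
    w ∈ schroderPaths n ↔ width w = 2 * n ∧ IsExcursion w := by
  rw [schroderPaths, Set.Finite.mem_toFinset]
  exact isSchroderPath_iff

theorem schroderPaths_zero : schroderPaths 0 = {[]} := by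
  ext w
  rw [mem_schroderPaths, Finset.mem_singleton]
  constructor
  · rintro ⟨hw, -⟩
    have : w.length ≤ width w := length_le_dx w
    exact List.length_eq_zero_iff.mp (by omega)
  · rintro rfl
    exact ⟨rfl, isExcursion_nil⟩

/-- The generating polynomial of Schröder paths by number of horizontal steps. -/
noncomputable def schroderPoly (n : ℕ) : Polynomial ℚ :=
  ∑ w ∈ schroderPaths n, X ^ horizCount w

theorem schroderPaths_succ (n : ℕ) :
    schroderPaths (n + 1) = (schroderPaths n).image (Step.horiz :: ·) ∪
      ((Finset.HasAntidiagonal.antidiagonal n).sigma fun ij => schroderPaths ij.1 ×ˢ schroderPaths ij.2).image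
        fun s => Step.up :: s.2.1 ++ Step.down :: s.2.2 := by
  ext w
  simp only [mem_schroderPaths, Finset.mem_union, Finset.mem_image, Finset.mem_sigma,
    Finset.mem_product, Finset.HasAntidiagonal.mem_antidiagonal]
  constructor
  · rintro ⟨hw, he⟩
    rcases isExcursion_iff.mp he with rfl | ⟨v, hv, rfl⟩ | ⟨a, b, ha, hb, rfl⟩
    · simp at hw
    · simp only [width_cons, Step.dx] at hw
      exact Or.inl ⟨v, ⟨by omega, hv⟩, rfl⟩
    · obtain ⟨i, hi⟩ := ha.even_width
      obtain ⟨j, hj⟩ := hb.even_width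
      simp only [List.cons_append, width_cons, width_append, Step.dx] at hw
      exact Or.inr ⟨⟨(i, j), (a, b)⟩, ⟨by simp only; omega, ⟨hi, ha⟩, ⟨hj, hb⟩⟩, rfl⟩
  · rintro (⟨v, ⟨hv, he⟩, rfl⟩ | ⟨⟨⟨i, j⟩, ⟨a, b⟩⟩, ⟨hij, ⟨hi, ha⟩, ⟨hj, hb⟩⟩, rfl⟩)
    · exact ⟨by simp only [width_cons, Step.dx]; omega, isExcursion_horiz_cons.mpr he⟩
    · refine ⟨?_, isExcursion_up_append_down ha hb⟩
      simp only at hij hi hj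
      simp only [List.cons_append, width_cons, width_append, Step.dx]
      omega

theorem schroderPoly_zero : schroderPoly 0 = 1 := by
  simp [schroderPoly, schroderPaths_zero, horizCount]

theorem schroderPoly_succ (n : ℕ) :
    schroderPoly (n + 1) = X * schroderPoly n +
      ∑ ij ∈ Finset.HasAntidiagonal.antidiagonal n, schroderPoly ij.1 * schroderPoly ij.2 := by
  rw [schroderPoly, schroderPaths_succ, Finset.sum_union, Finset.sum_image, Finset.sum_image,
    Finset.sum_sigma]
  · congr 1
    · rw [schroderPoly, Finset.mul_sum]
      exact Finset.sum_congr rfl fun w _ => by simp [horizCount, pow_succ']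
    · refine Finset.sum_congr rfl fun ij _ => ?_
      rw [schroderPoly, schroderPoly, Finset.sum_mul_sum, Finset.sum_product]
      exact Finset.sum_congr rfl fun a _ => Finset.sum_congr rfl fun b _ => by
        simp [horizCount, pow_add]
  · rintro ⟨⟨i, j⟩, ⟨a, b⟩⟩ h1 ⟨⟨i', j'⟩, ⟨a', b'⟩⟩ h2 H
    simp only [Finset.mem_coe, Finset.mem_sigma, Finset.mem_product, mem_schroderPaths] at h1 h2
    obtain ⟨-, ⟨hi, ha⟩, ⟨hj, hb⟩⟩ := h1
    obtain ⟨-, ⟨hi', ha'⟩, ⟨hj', hb'⟩⟩ := h2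
    obtain ⟨rfl, rfl⟩ := append_down_injective ha ha' (List.cons.inj H).2
    obtain rfl : i = i' := by omega
    obtain rfl : j = j' := by dsimp only at hj hj'; omega
    rfl
  · exact fun _ _ _ _ H => (List.cons.inj H).2
  · rw [Finset.disjoint_left]
    intro w h1 h2
    obtain ⟨v, -, rfl⟩ := Finset.mem_image.mp h1
    obtain ⟨s, -, hs⟩ := Finset.mem_image.mp h2
    simp at hs

theorem schroderPoly_eq_P (n : ℕ) : schroderPoly n = P n := by
  induction n using Nat.strong_induction_on with
  | _ n ih =>
    rcases n with _ | n
    · rw [schroderPoly_zero, P_zero]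
    · rw [schroderPoly_succ, P_succ, ih n (by omega)]
      congr 1
      refine Finset.sum_congr rfl fun ij hij => ?_
      have := Finset.HasAntidiagonal.mem_antidiagonal.mp hij
      rw [ih ij.1 (by omega), ih ij.2 (by omega)]

theorem P_coeff (n k : ℕ) :
    (P n).coeff k = (((schroderPaths n).filter fun w => horizCount w = k).card : ℚ) := by
  rw [← schroderPoly_eq_P, schroderPoly, Polynomial.finsetSum_coeff]
  simp [Polynomial.coeff_X_pow, eq_comm]

/-! ### Three-term recurrences and Lassalle's formula -/

theorem P_one : P 1 = X + 1 := by
  rw [P_succ, P_zero]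
  simp [P_zero]

/-- With `D = (1 - t z)² - 4 z`, differentiating `r² = D` gives `2 D r' = D' r`. Substituting `r = 1
- t z - 2 z p` makes this a linear equation for `z p`, whose coefficient of `z^(n+2)` is the
recurrence; the inhomogeneous term `1 + t z` has degree too low to contribute. -/
theorem P_recurrence (n : ℕ) :
    ((n : Polynomial ℚ) + 3) * P (n + 2) =
      ((X : Polynomial ℚ) + 2) * (2 * (n : Polynomial ℚ) + 3) * P (n + 1) -
        (X : Polynomial ℚ) ^ 2 * (n : Polynomial ℚ) * P n := by
  obtain ⟨r, hr, -, hrP⟩ := exists_sqrt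
  set p := mk P with hp
  set z : PowerSeries (Polynomial ℚ) := PowerSeries.X with hz
  set t : PowerSeries (Polynomial ℚ) := PowerSeries.C X with ht
  set d := PowerSeries.derivative (Polynomial ℚ) with hd
  have hdz : d z = 1 := PowerSeries.derivative_X
  have hdt : d t = 0 := PowerSeries.derivative_C
  have hC2 : (2 : PowerSeries (Polynomial ℚ)) = PowerSeries.C 2 := (map_ofNat _ 2).symm
  have hC4 : (4 : PowerSeries (Polynomial ℚ)) = PowerSeries.C 4 := (map_ofNat _ 4).symm
  have hd2 : d 2 = 0 := by rw [hC2]; exact PowerSeries.derivative_C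
  have hd4 : d 4 = 0 := by rw [hC4]; exact PowerSeries.derivative_C
  have h1 := congrArg d hr
  simp only [sq, Derivation.leibniz, map_sub, Derivation.map_one_eq_zero, hdz, hdt, hd4,
    smul_eq_mul] at h1
  have h2 := congrArg d hrP
  simp only [Derivation.leibniz, map_sub, Derivation.map_one_eq_zero, hdz, hdt, hd2,
    smul_eq_mul] at h2
  have four : (4 : PowerSeries (Polynomial ℚ)) ≠ 0 := fun h => by
    simpa [hC4] using congrArg constantCoeff h
  have h3 : (p + z * d p) - (2 * t + 4) * (z * (p + z * d p)) + t ^ 2 * (z * (z * (p + z * d p)))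
      + (t + 2) * (z * p) - t ^ 2 * (z * (z * p)) = 1 + t * z := by
    refine mul_left_cancel₀ four ?_
    -- Multiplying `h1` by `r` lets `r²` be replaced by the discriminant, with no division by `r`.
    linear_combination 2 * ((1 - t * z) ^ 2 - 4 * z) * h2 + 2 * d r * hr - r * h1 +
      2 * (t + 2 - t ^ 2 * z) * hrP
  have hq : ∀ m, coeff m (p + z * d p) = ((m : Polynomial ℚ) + 1) * P m := by
    intro m
    rcases m with _ | m
    · simp [hp, hz]
    · rw [map_add, hz, PowerSeries.coeff_succ_X_mul, hd, PowerSeries.coeff_derivative, hp,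
        PowerSeries.coeff_mk]
      push_cast
      ring
  generalize p + z * d p = q at h3 hq
  have e1 : 2 * t + 4 = PowerSeries.C (2 * X + 4) := by
    rw [ht, map_add, map_mul, map_ofNat, map_ofNat]
  have e2 : t + 2 = PowerSeries.C (X + 2) := by rw [ht, map_add, map_ofNat]
  have e3 : t ^ 2 = PowerSeries.C (X ^ 2) := by rw [ht, map_pow]
  have h4 := congrArg (coeff (n + 2)) h3
  rw [e1, e2, e3, ht, hz] at h4
  simp only [map_sub, map_add (coeff (n + 2)), PowerSeries.coeff_C_mul,
    PowerSeries.coeff_succ_X_mul, hq, hp, PowerSeries.coeff_mk, PowerSeries.coeff_one,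
    PowerSeries.coeff_X] at h4
  simp at h4
  linear_combination h4

theorem narayana_coeff (n j : ℕ) :
    (narayana n).coeff j = (n.choose (j + 1) : ℚ) * (n.choose j : ℚ) / (n : ℚ) := by
  rw [narayana, Polynomial.finsetSum_coeff]
  simp only [Polynomial.coeff_C_mul_X_pow]
  rw [Finset.sum_ite_eq]
  split_ifs with hj
  · rfl
  · rw [Nat.choose_eq_zero_of_lt (by rw [Finset.mem_range] at hj; omega)]
    simp

theorem natCast_mul_narayana_coeff (n j : ℕ) :
    (n : ℚ) * (narayana n).coeff j = (n.choose (j + 1) : ℚ) * (n.choose j : ℚ) := by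
  rw [narayana_coeff]
  rcases n with _ | n
  · simp
  · field_simp

theorem choose_succ_eq_div (n k : ℕ) :
    (n.choose (k + 1) : ℚ) = n.choose k * ((n : ℚ) - k) / (k + 1) := by
  rw [eq_div_iff (by positivity)]
  rcases le_or_gt k n with hk | hk
  · rw [← Nat.cast_sub hk]
    exact_mod_cast Nat.choose_succ_right_eq n k
  · simp [Nat.choose_eq_zero_of_lt hk, Nat.choose_eq_zero_of_lt (Nat.lt_succ_of_lt hk)]

theorem narayana_recurrence (n : ℕ) :
    ((n : Polynomial ℚ) + 3) * narayana (n + 2) =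
      ((X : Polynomial ℚ) + 1) * (2 * (n : Polynomial ℚ) + 3) * narayana (n + 1) -
        ((X : Polynomial ℚ) - 1) ^ 2 * (n : Polynomial ℚ) * narayana n := by
  have h2 : ((n : Polynomial ℚ) + 3) * narayana (n + 2) =
      C ((n : ℚ) + 3) * narayana (n + 2) := by
    rw [map_add, map_natCast, map_ofNat]
  have h1 : ((X : Polynomial ℚ) + 1) * (2 * (n : Polynomial ℚ) + 3) * narayana (n + 1) =
      C (2 * (n : ℚ) + 3) * (narayana (n + 1) + X * narayana (n + 1)) := by
    rw [map_add, map_mul, map_natCast, map_ofNat, map_ofNat]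
    ring
  -- The factor `n` stays attached to `narayana n`, cancelling its denominator, so `n = 0` needs no
  -- separate case.
  have h0 : ((X : Polynomial ℚ) - 1) ^ 2 * (n : Polynomial ℚ) * narayana n =
      C (n : ℚ) * narayana n - C 2 * (X * (C (n : ℚ) * narayana n)) +
        X * (X * (C (n : ℚ) * narayana n)) := by
    rw [map_natCast, map_ofNat]
    ring
  have hn1 : ((n : ℚ) + 1) ≠ 0 := by positivity
  have hn2 : ((n : ℚ) + 2) ≠ 0 := by positivity
  rw [h2, h1, h0]
  ext j
  rcases j with _ | _ | j
  · simp only [Polynomial.coeff_sub, Polynomial.coeff_add, Polynomial.coeff_C_mul,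
      Polynomial.coeff_X_mul_zero, natCast_mul_narayana_coeff]
    simp only [narayana_coeff]
    simp
    field_simp
    ring
  · simp only [Polynomial.coeff_sub, Polynomial.coeff_add, Polynomial.coeff_C_mul, zero_add,
      Polynomial.coeff_X_mul_zero, Polynomial.coeff_X_mul _ 0, natCast_mul_narayana_coeff]
    simp only [narayana_coeff, choose_succ_eq_div]
    simp
    field_simp
    ring
  · simp only [Polynomial.coeff_sub, Polynomial.coeff_add, Polynomial.coeff_C_mul,
      Polynomial.coeff_X_mul, natCast_mul_narayana_coeff]
    -- Pascal's rule lowers the upper indices to `n`; the ratio formula then reduces every binomial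
    -- to a multiple of `n.choose j`.
    simp only [narayana_coeff, Nat.choose_succ_succ', choose_succ_eq_div]
    push_cast
    simp only [choose_succ_eq_div]
    push_cast
    field_simp
    ring

theorem lassalle (n : ℕ) (hn : 1 ≤ n) : X * narayana n = (P n).comp (X - 1) := by
  have key : ∀ n : ℕ, (X : Polynomial ℚ) * narayana (n + 1) = (P (n + 1)).comp (X - 1) ∧
      X * narayana (n + 2) = (P (n + 2)).comp (X - 1) := by
    -- The formula fails at index 0, where the sides are 0 and 1. The recurrence only needs it
    -- multiplied by `n`, so the induction can still start there.
    have step : ∀ n : ℕ, (n : Polynomial ℚ) * (X * narayana n) = (n : Polynomial ℚ) * (P n).comp (X - 1) →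
        X * narayana (n + 1) = (P (n + 1)).comp (X - 1) →
        X * narayana (n + 2) = (P (n + 2)).comp (X - 1) := by
      intro n h0 h1
      have hP := congrArg (fun p : Polynomial ℚ => p.comp (X - 1)) (P_recurrence n)
      have h23 : ((2 : Polynomial ℚ).comp (X - 1) = 2) ∧ ((3 : Polynomial ℚ).comp (X - 1) = 3) :=
        ⟨Polynomial.ofNat_comp 2, Polynomial.ofNat_comp 3⟩
      simp only [Polynomial.mul_comp, Polynomial.sub_comp, Polynomial.add_comp,
        Polynomial.X_comp, Polynomial.natCast_comp, h23,
        Polynomial.pow_comp] at hP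
      have hN := narayana_recurrence n
      have h3 : ((n : Polynomial ℚ) + 3) ≠ 0 := by exact_mod_cast (by omega : n + 3 ≠ 0)
      refine mul_left_cancel₀ h3 ?_
      rw [show (X : Polynomial ℚ) - 1 + 2 = X + 1 by ring] at hP
      linear_combination (X : Polynomial ℚ) * hN - hP +
        ((X : Polynomial ℚ) + 1) * (2 * (n : Polynomial ℚ) + 3) * h1 -
        ((X : Polynomial ℚ) - 1) ^ 2 * h0
    have h1 : X * narayana 1 = (P 1).comp (X - 1) := by
      simp [P_one, narayana]
    intro n
    induction n with
    | zero => exact ⟨h1, step 0 (by simp) h1⟩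
    | succ n ih => exact ⟨ih.2, step (n + 1) (by rw [ih.1]) ih.2⟩
  obtain ⟨m, rfl⟩ := Nat.exists_eq_add_of_le' hn
  exact (key m).1

end SuperNarayana

theorem mainTheorem5 :
    -- the coefficient of `t^k` in `P_n(t)` counts Schröder paths by horizontal steps
    (∀ n k : ℕ, (SuperNarayana.P n).coeff k =
      (((SuperNarayana.schroderPaths n).filter fun w => SuperNarayana.horizCount w = k).card : ℚ)) ∧
    -- the generating function `∑ P_n(t) z^n = (1 - tz - √((1 - tz)² - 4z)) / (2z)`, where the
    -- square root is the formal power series in `z` over `ℚ[t]` with constant term `1`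
    (∃ r : PowerSeries (Polynomial ℚ),
      r ^ 2 = (1 - PowerSeries.C (Polynomial.X : Polynomial ℚ) * PowerSeries.X) ^ 2
        - 4 * PowerSeries.X ∧
      PowerSeries.constantCoeff r = 1 ∧
      2 * PowerSeries.X * PowerSeries.mk SuperNarayana.P =
        1 - PowerSeries.C (Polynomial.X : Polynomial ℚ) * PowerSeries.X - r) ∧
    -- the generating polynomial for horizontal steps is `(t + 1) c_n(t + 1)`
    (∀ n : ℕ, 1 ≤ n →
      ∑ w ∈ SuperNarayana.schroderPaths n, (Polynomial.X : Polynomial ℚ) ^ SuperNarayana.horizCount w =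
        (Polynomial.X + 1) * (SuperNarayana.narayana n).comp (Polynomial.X + 1)) ∧
    -- Lassalle's formula `t c_n(t) = P_n(t - 1)`
    (∀ n : ℕ, 1 ≤ n →
      Polynomial.X * SuperNarayana.narayana n = (SuperNarayana.P n).comp (Polynomial.X - 1)) := by
  refine ⟨SuperNarayana.P_coeff, SuperNarayana.exists_sqrt, fun n hn => ?_,
    SuperNarayana.lassalle⟩
  -- Substituting `t + 1` undoes the shift in Lassalle's formula.
  have hL := congrArg (fun p : Polynomial ℚ => p.comp (Polynomial.X + 1))
    (SuperNarayana.lassalle n hn)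
  simp only [Polynomial.mul_comp, Polynomial.X_comp, Polynomial.comp_assoc] at hL
  rw [hL]
  simpa [SuperNarayana.schroderPoly] using SuperNarayana.schroderPoly_eq_P n
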